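/- Let $k \ge 2$ and $\ell \ge 2$ be integers, and let $G$ be a finite simple undirected graph of order $n$ that is $k$-connected (that is, $n > k$ and deleting fewer than $k$ vertices from $G$ always leaves a connected graph). Suppose that $$n \ge \max\left\{k\ell+\max\{k\ell,\,6\ell+2\}+3k+2\ell-6,\ \ 6k+20\ell-8-2\left\lceil \frac{k-2}{k} \right\rceil\right\}$$ and that the minimum degree satisfies $\delta(G) \ge \frac{n}{2}$. If $G$ has $\ell$ pairwise edge-disjoint Hamiltonian cycles, then there are $\ell$ pairwise edge-disjoint Hamiltonian cycles $H_1, H_2, \ldots, H_\ell$ in $G$ such that the graph $G - \bigcup_{1 \le i \le \ell} E(H_i)$, obtained from $G$ by deleting all edges of these cycles, is $k$-connected. -/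

import Mathlib

/-- `G` is `k`-connected, that is, its vertex connectivity is at least `k`: it has more than `k`
vertices, and deleting fewer than `k` vertices always leaves a connected graph. -/
def SimpleGraph.IsKConnected {V : Type*} [Fintype V] (G : SimpleGraph V) (k : ℕ) : Prop :=
  k < Fintype.card V ∧ ∀ S : Finset V, S.card < k → (G.induce {v : V | v ∉ S}).Connected

/-- The closed walks `H i`, based at `v i`, are Hamiltonian cycles of `G`, and no edge of `G`
lies on two of them. -/
def SimpleGraph.IsEdgeDisjointHamiltonianCycles {V : Type*} [DecidableEq V] (G : SimpleGraph V)
    {ℓ : ℕ} (v : Fin ℓ → V) (H : ∀ i, G.Walk (v i) (v i)) : Prop :=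
  (∀ i, (H i).IsHamiltonianCycle) ∧
    ∀ i j, i ≠ j → Disjoint (H i).edgeSet (H j).edgeSet

/-! Let `n` be the order. If deleting the given cycles leaves a `k`-connected graph, nothing is to
be done. Otherwise fewer than `k` vertices separate the remaining graph into `A` and `B`. A vertex
loses at most `2ℓ` edges with the cycles, so in `G` every vertex of `A` has at most `2ℓ` neighbours
in `B`, and conversely. With minimum degree `n/2`, both parts have about `n/2` vertices and are
dense. Sending each separating vertex to the part where it has more neighbours splits `V` into two
robust sides `X` and `Y` (`exists_robust_partition`).

The old cycles are then discarded, and new ones are built that spare a reserved matching. As `G` is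
`k`-connected, Kőnig's theorem gives `k` disjoint edges between `X` and `Y`
(`exists_matching_of_le_card_cover`). The degree condition gives `ℓ` further pairs of crossing edges
(`exists_disjoint_crossingPairs_of_partition`), and density gives `ℓ` edge-disjoint spanning paths
with prescribed ends in each side (`exists_disjoint_spanning_paths`, by a Bondy–Chvátal closure).
Each crossing pair closes two paths into a Hamiltonian cycle. After deleting these cycles and fewer
than `k` vertices, each side stays connected and some matching edge survives
(`isKConnected_of_robust_partition`). -/

open Finset

/-! ### Counting along lists -/

section Chains

variable {α : Type*}

/-- The successor of an entry satisfying `P` exists and fails `Q`. This is the count behind Ore's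
theorem: the predicates will be adjacency to the two ends of a missing edge. -/
theorem List.countP_add_countP_tail_le_of_isChain {P Q : α → Bool} {x : α} {t : List α}
    (h : (x :: t).IsChain fun a b => ¬(P a = true ∧ Q b = true))
    (hlast : ∀ z ∈ (x :: t).getLast?, P z = false) :
    (x :: t).countP P + t.countP Q ≤ t.length := by
  induction t generalizing x with
  | nil => simp at hlast; simp [hlast]
  | cons y t ih =>
    rw [List.isChain_cons_cons] at h
    have := ih h.2 (by simpa using hlast)
    rw [List.countP_cons (l := y :: t), List.countP_cons (l := t) (p := Q), List.length_cons]
    have h1 := h.1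
    by_cases hP : P x = true <;> by_cases hQ : Q y = true <;> simp [hP, hQ] at h1 ⊢ <;> omega

theorem List.countP_add_countP_le_of_isChain {P Q : α → Bool} {l : List α}
    (h : l.IsChain fun a b => ¬(P a = true ∧ Q b = true))
    (hlast : ∀ z ∈ l.getLast?, P z = false) :
    l.countP P + l.countP Q ≤ l.length := by
  cases l with
  | nil => simp
  | cons x t =>
    have := List.countP_add_countP_tail_le_of_isChain h hlast
    rw [List.countP_cons (p := Q), List.length_cons]
    split <;> omega

theorem List.exists_split_of_not_isChain {R : α → α → Prop} {l : List α} (h : ¬ l.IsChain R) :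
    ∃ l₁ l₂ x y, l = l₁ ++ l₂ ∧ l₁.getLast? = some x ∧ l₂.head? = some y ∧ ¬ R x y := by
  rw [List.isChain_iff_forall_rel_of_append_cons_cons] at h
  push Not at h
  obtain ⟨x, y, c, d, h1, h2⟩ := h
  exact ⟨c ++ [x], y :: d, x, y, by simp [h1], by simp, by simp, h2⟩

end Chains

/-! ### Spanning paths by degree closure -/

namespace SimpleGraph

variable {V : Type*} [DecidableEq V]

open Classical in
/-- The number of neighbours of `v` in the vertex set `Z`. -/
noncomputable def degOn (G : SimpleGraph V) (Z : Finset V) (v : V) : ℕ :=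
  #{w ∈ Z | G.Adj v w}

/-- The vertex set `X` is spanned by a path of `G` from `a` to `b`, given as a list. -/
def HasSpanningPath (G : SimpleGraph V) (X : Finset V) (a b : V) : Prop :=
  ∃ l : List V, l.Nodup ∧ l.toFinset = X ∧ l.IsChain G.Adj ∧ l.head? = some a ∧
    l.getLast? = some b

open Classical in
theorem degOn_toFinset (G : SimpleGraph V) {l : List V} (hl : l.Nodup) (v : V) :
    G.degOn l.toFinset v = l.countP fun w => decide (G.Adj v w) := by
  rw [degOn, List.countP_eq_length_filter, ← List.toFinset_card_of_nodup (hl.filter _)]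
  congr 1
  ext
  simp

omit [DecidableEq V] in
theorem degOn_mono {G H : SimpleGraph V} (h : G ≤ H) (Z : Finset V) (v : V) :
    G.degOn Z v ≤ H.degOn Z v := by
  classical
  exact card_le_card fun w => by simpa using fun hw ha => ⟨hw, h ha⟩

omit [DecidableEq V] in
theorem degOn_mono_right (G : SimpleGraph V) {Z W : Finset V} (h : Z ⊆ W) (v : V) :
    G.degOn Z v ≤ G.degOn W v := by
  classical
  exact card_le_card fun w => by simpa using fun hw ha => ⟨h hw, ha⟩

/-- Bondy–Chvátal step for paths with fixed ends. Removing the new edge cuts the path into `c` and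
`d`. Either some segment can be reversed to avoid that edge, or counting neighbours along `c` and
`d` bounds the degree sum by `#X`. -/
theorem HasSpanningPath.of_sup_edge {G : SimpleGraph V} {X : Finset V} {a b u v : V}
    (huv : u ≠ v) (hdeg : #X + 1 ≤ G.degOn X u + G.degOn X v)
    (h : (G ⊔ edge u v).HasSpanningPath X a b) : G.HasSpanningPath X a b := by
  classical
  obtain ⟨l, hnd, rfl, hch, hhead, hlast⟩ := h
  by_cases hG : l.IsChain G.Adj
  · exact ⟨l, hnd, rfl, hG, hhead, hlast⟩
  obtain ⟨c, d, x, y, rfl, hcx, hdy, hxy⟩ := List.exists_split_of_not_isChain hG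
  have hx : (G ⊔ edge u v).Adj x y := by
    have := hch
    rw [List.isChain_append] at this
    exact this.2.2 x hcx y hdy
  have huv' : (x = u ∧ y = v) ∨ (x = v ∧ y = u) := by
    rw [sup_adj, edge_adj] at hx
    tauto
  clear hG
  wlog hxu : x = u ∧ y = v generalizing u v
  · refine this huv.symm (by omega) ?_ ?_ ?_ (by tauto)
    · rwa [edge_comm]
    · rwa [edge_comm]
    · tauto
  obtain ⟨rfl, rfl⟩ := hxu
  clear huv' hx
  have hxc : x ∈ c := List.mem_of_getLast? hcx
  have hyd : y ∈ d := List.mem_of_head? hdy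
  have hnd' := List.nodup_append'.1 hnd
  have hch' := List.isChain_append.1 hch
  have hc : c.IsChain G.Adj := by
    refine List.IsChain.imp_of_mem_imp ?_ hch'.1
    intro p q hp hq hpq
    rw [sup_adj, edge_adj] at hpq
    have : y ∉ c := fun hy => hnd'.2.2 hy hyd
    rcases hpq with hpq | ⟨⟨rfl, rfl⟩ | ⟨rfl, rfl⟩, -⟩
    · exact hpq
    · exact absurd hq this
    · exact absurd hp this
  have hd : d.IsChain G.Adj := by
    refine List.IsChain.imp_of_mem_imp ?_ hch'.2.1
    intro p q hp hq hpq
    rw [sup_adj, edge_adj] at hpq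
    have : x ∉ d := fun hy => hnd'.2.2 hxc hy
    rcases hpq with hpq | ⟨⟨rfl, rfl⟩ | ⟨rfl, rfl⟩, -⟩
    · exact hpq
    · exact absurd hp this
    · exact absurd hq this
  by_cases h1 : c.IsChain fun p q => ¬(decide (G.Adj x p) = true ∧ decide (G.Adj y q) = true)
  · by_cases h2 : d.IsChain fun p q => ¬(decide (G.Adj x p) = true ∧ decide (G.Adj y q) = true)
    -- The last entry `x` of `c` is not its own neighbour. Reversing `d` puts `y` last and exchanges
    -- the two predicates.
    · have e1 := List.countP_add_countP_le_of_isChain h1 (by simp [hcx])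
      have e2 := List.countP_add_countP_le_of_isChain (l := d.reverse)
        (P := fun q => decide (G.Adj y q)) (Q := fun p => decide (G.Adj x p))
        (by rw [List.isChain_reverse]; exact h2.imp fun p q h => by tauto) (by simp [hdy])
      rw [List.countP_reverse, List.countP_reverse, List.length_reverse] at e2
      rw [degOn_toFinset _ hnd, degOn_toFinset _ hnd, List.toFinset_card_of_nodup hnd,
        List.countP_append, List.countP_append, List.length_append] at hdeg
      omega
    · obtain ⟨c', d', p, q, rfl, hp, hq, hpq⟩ := List.exists_split_of_not_isChain h2
      simp only [decide_eq_true_eq, not_not] at hpq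
      have hd1 := List.isChain_append.1 hd
      have hc0 : c ≠ [] := by rintro rfl; simp at hcx
      have hc' : c' ≠ [] := by rintro rfl; simp at hp
      have hd' : d' ≠ [] := by rintro rfl; simp at hq
      -- Reversing the segment from `y` to `p` replaces the edges `xy` and `pq` by `xp` and `yq`.
      refine ⟨c ++ (c'.reverse ++ d'), ?_, ?_, ?_, ?_, ?_⟩
      · exact (List.Perm.nodup_iff
          (((List.reverse_perm _).symm.append_right _).append_left _)).1 hnd
      · ext; simp
      · have hy : c'.head? = some y := by
          rwa [List.head?_append_of_ne_nil _ hc'] at hdy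
        rw [List.isChain_append, List.isChain_append, List.isChain_reverse]
        refine ⟨hc, ⟨hd1.1.imp fun _ _ h => h.symm, hd1.2.1, ?_⟩, ?_⟩
        · simpa [hy, hq] using hpq.2
        · simpa [hcx, hp] using hpq.1
      · rw [List.head?_append_of_ne_nil _ hc0] at hhead ⊢
        exact hhead
      · rw [List.getLast?_append_of_ne_nil _ (by simp [hd']), List.getLast?_append_of_ne_nil _ hd'] at hlast ⊢
        exact hlast
  · obtain ⟨c', d', p, q, rfl, hp, hq, hpq⟩ := List.exists_split_of_not_isChain h1
    simp only [decide_eq_true_eq, not_not] at hpq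
    have hd1 := List.isChain_append.1 hc
    have hc' : c' ≠ [] := by rintro rfl; simp at hp
    have hd' : d' ≠ [] := by rintro rfl; simp at hq
    have hd0 : d ≠ [] := by rintro rfl; simp at hdy
    refine ⟨c' ++ (d'.reverse ++ d), ?_, ?_, ?_, ?_, ?_⟩
    · rw [List.append_assoc] at hnd
      exact (List.Perm.nodup_iff
          (((List.reverse_perm _).symm.append_right _).append_left _)).1 hnd
    · ext; simp
    · have hy : d'.getLast? = some x := by
        rwa [List.getLast?_append_of_ne_nil _ hd'] at hcx
      rw [List.isChain_append, List.isChain_append, List.isChain_reverse]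
      refine ⟨hd1.1, ⟨hd1.2.1.imp fun _ _ h => h.symm, hd, ?_⟩, ?_⟩
      · simpa [hq, hdy] using hpq.2.symm
      · simpa [hp, hy] using hpq.1.symm
    · rw [List.append_assoc, List.head?_append_of_ne_nil _ hc'] at hhead
      rwa [List.head?_append_of_ne_nil _ hc']
    · rw [List.getLast?_append_of_ne_nil _ hd0] at hlast
      rw [List.getLast?_append_of_ne_nil _ (by simp [hd0]), List.getLast?_append_of_ne_nil _ hd0]
      exact hlast

theorem HasSpanningPath.of_pairwise_adj {G : SimpleGraph V} {X : Finset V} {a b : V}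
    (ha : a ∈ X) (hb : b ∈ X) (hab : a ≠ b)
    (h : ∀ u ∈ X, ∀ v ∈ X, u ≠ v → G.Adj u v) : G.HasSpanningPath X a b := by
  have hnd : (a :: (((X.erase a).erase b).toList ++ [b])).Nodup := by
    simp [List.nodup_append', hab, Finset.nodup_toList]
  refine ⟨_, hnd, ?_, ?_, by simp, ?_⟩
  · ext x
    simp
    by_cases hxa : x = a <;> by_cases hxb : x = b <;> simp_all
  · refine List.IsChain.imp_of_mem_imp ?_ (List.Pairwise.isChain hnd)
    intro p q hp hq hpq
    simp at hp hq
    refine h p ?_ q ?_ hpq <;> aesop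
  · rw [List.getLast?_cons]
    simp

/-- A graph that is dense on `X`, apart from a few vertices outside `A` of smaller degree, has a
path spanning `X` between any two vertices of `X`. -/
theorem hasSpanningPath_of_degOn [Finite V] {G : SimpleGraph V} {A X : Finset V} {a b : V}
    (hAX : A ⊆ X) (ha : a ∈ X) (hb : b ∈ X) (hab : a ≠ b)
    (hA : ∀ u ∈ A, #X + 1 ≤ 2 * G.degOn X u)
    (hX : ∀ u ∈ X, u ∉ A → #X + 2 ≤ G.degOn X u + #A)
    (hcard : #X + 1 ≤ 2 * #A) : G.HasSpanningPath X a b := by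
  classical
  by_contra hno
  -- A maximal counterexample above `G` serves as the closure. It turns out complete on `X`, where a
  -- spanning path is trivial.
  obtain ⟨H, hGH, hH⟩ := Finite.exists_le_maximal (p := fun H : SimpleGraph V =>
    ¬ H.HasSpanningPath X a b) hno
  have key : ∀ u v, u ≠ v → #X + 1 ≤ H.degOn X u + H.degOn X v → H.Adj u v := by
    intro u v huv hdeg
    by_contra hadj
    have hlt : H < H ⊔ edge u v := lt_sup_edge _ _ _ huv hadj
    refine hH.1 (HasSpanningPath.of_sup_edge huv hdeg ?_)
    by_contra hne
    exact hlt.not_ge (hH.2 hne hlt.le)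
  have hmono := fun v => degOn_mono hGH X v
  have hAA : ∀ u ∈ A, ∀ v ∈ A, u ≠ v → H.Adj u v := fun u hu v hv huv =>
    key u v huv (by have := hA u hu; have := hA v hv; have := hmono u; have := hmono v; omega)
  have hdegA : ∀ u ∈ A, #A ≤ H.degOn X u + 1 := by
    intro u hu
    rw [← card_erase_add_one hu]
    gcongr
    refine card_le_card fun w hw => ?_
    rw [mem_erase] at hw
    simpa using ⟨hAX hw.2, hAA u hu w hw.2 hw.1.symm⟩
  -- Since `A` is now a clique, its vertices have degree at least `#A - 1`, which lifts the degree
  -- sum with an outside vertex to the threshold.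
  have hXA : ∀ u ∈ X, u ∉ A → ∀ v ∈ A, H.Adj u v := fun u hu hu' v hv =>
    key u v (by rintro rfl; exact hu' hv)
      (by have := hX u hu hu'; have := hdegA v hv; have := hmono u; omega)
  have hdegX : ∀ u ∈ X, u ∉ A → #A ≤ H.degOn X u := by
    intro u hu hu'
    refine card_le_card fun w hw => ?_
    simpa using ⟨hAX hw, hXA u hu hu' w hw⟩
  refine hH.1 (HasSpanningPath.of_pairwise_adj ha hb hab fun u hu v hv huv => ?_)
  by_cases huA : u ∈ A
  · by_cases hvA : v ∈ A
    · exact hAA u huA v hvA huv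
    · exact (hXA v hv hvA u huA).symm
  · by_cases hvA : v ∈ A
    · exact hXA u hu huA v hvA
    · exact key u v huv (by have := hdegX u hu huA; have := hdegX v hv hvA; omega)

end SimpleGraph

/-! ### Edge-disjoint spanning paths and Hamiltonian cycles -/

namespace SimpleGraph

variable {V : Type*} [DecidableEq V]

theorem HasSpanningPath.exists_isPath {G : SimpleGraph V} {X : Finset V} {a b : V}
    (h : G.HasSpanningPath X a b) :
    ∃ p : G.Walk a b, p.IsPath ∧ p.support.toFinset = X := by
  obtain ⟨l, hnd, hX, hch, hhead, hlast⟩ := h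
  have hne : l ≠ [] := by rintro rfl; simp at hhead
  have ha : l.head hne = a := by rwa [List.head?_eq_some_head hne, Option.some_inj] at hhead
  have hb : l.getLast hne = b := by rwa [List.getLast?_eq_some_getLast hne, Option.some_inj] at hlast
  subst ha hb
  exact ⟨Walk.ofSupport l hne hch, by rw [Walk.isPath_def, Walk.support_ofSupport]; exact hnd,
    by rw [Walk.support_ofSupport]; exact hX⟩

theorem degOn_le_add_degOn_fromEdgeSet (G : SimpleGraph V) (E : Set (Sym2 V)) (Z : Finset V)
    (v : V) : G.degOn Z v ≤ (G.deleteEdges E).degOn Z v + (fromEdgeSet E).degOn Z v := by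
  classical
  refine le_trans (card_le_card fun w hw => ?_) (card_union_le _ _)
  rw [mem_filter] at hw
  simp only [mem_union, mem_filter, deleteEdges_adj, fromEdgeSet_adj, hw, true_and]
  have := hw.2.ne
  tauto

theorem degOn_fromEdgeSet_iUnion_le {ι : Type*} [Fintype ι] {E : ι → Set (Sym2 V)} {Z : Finset V}
    {v : V} {d : ℕ} (h : ∀ i, (fromEdgeSet (E i)).degOn Z v ≤ d) :
    (fromEdgeSet (⋃ i, E i)).degOn Z v ≤ Fintype.card ι * d := by
  classical
  refine (card_le_card (t := univ.biUnion fun i => {w ∈ Z | (fromEdgeSet (E i)).Adj v w})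
    fun w hw => ?_).trans ?_
  · simp only [mem_filter, fromEdgeSet_adj, Set.mem_iUnion] at hw
    obtain ⟨hw, ⟨i, hi⟩, hne⟩ := hw
    simp only [mem_biUnion, mem_filter, fromEdgeSet_adj, mem_univ, true_and]
    exact ⟨i, hw, hi, hne⟩
  · rw [← card_univ]
    refine card_biUnion_le_card_mul _ _ _ fun i _ => ?_
    convert h i using 1
    rw [degOn]
    congr!

theorem degOn_fromEdgeSet_le_ncard {G : SimpleGraph V} {a b : V} (p : G.Walk a b) (Z : Finset V)
    (v : V) : (fromEdgeSet p.edgeSet).degOn Z v ≤ (p.toSubgraph.neighborSet v).ncard := by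
  classical
  rw [degOn, ← Set.ncard_coe_finset]
  refine Set.ncard_le_ncard (fun w hw => ?_) ?_
  · simp only [coe_filter, fromEdgeSet_adj] at hw
    exact Walk.adj_toSubgraph_iff_mem_edges.2 hw.2.1
  · refine (p.support.toFinset.finite_toSet).subset fun w hw => ?_
    simpa using Walk.mem_support_of_adj_toSubgraph (Subgraph.adj_symm _ hw)

theorem Walk.IsPath.degOn_fromEdgeSet_le {G : SimpleGraph V} {a b : V} {p : G.Walk a b}
    (hp : p.IsPath) (Z : Finset V) (v : V) : (fromEdgeSet p.edgeSet).degOn Z v ≤ 2 := by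
  refine (degOn_fromEdgeSet_le_ncard p Z v).trans ?_
  by_cases hv : v ∈ p.support
  · by_cases hnil : p.Nil
    · have : p.toSubgraph.neighborSet v = ∅ := by
        ext w
        rw [Subgraph.mem_neighborSet, Walk.adj_toSubgraph_iff_mem_edges]
        cases hnil
        simp
      simp [this]
    · obtain ⟨i, rfl, hi⟩ := Walk.mem_support_iff_exists_getVert.1 hv
      rcases eq_or_ne i 0 with rfl | h0
      · rw [Walk.getVert_zero, hp.neighborSet_toSubgraph_startpoint hnil]
        simp
      · rcases hi.lt_or_eq with hi | rfl
        · exact (hp.ncard_neighborSet_toSubgraph_internal_eq_two h0 hi).le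
        · rw [Walk.getVert_length, hp.neighborSet_toSubgraph_endpoint hnil]
          simp
  · have : p.toSubgraph.neighborSet v = ∅ := by
      ext w
      simpa using fun h => hv (Walk.mem_support_of_adj_toSubgraph h)
    simp [this]

theorem Walk.IsHamiltonianCycle.degOn_fromEdgeSet_le {G : SimpleGraph V} {a : V} {p : G.Walk a a}
    (hp : p.IsHamiltonianCycle) (Z : Finset V) (v : V) :
    (fromEdgeSet p.edgeSet).degOn Z v ≤ 2 :=
  (degOn_fromEdgeSet_le_ncard p Z v).trans
    (hp.isCycle.ncard_neighborSet_toSubgraph_eq_two (hp.mem_support v)).le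

/-- A graph that is dense enough on `X` has `j` pairwise edge-disjoint paths spanning `X`, with
prescribed ends. -/
theorem exists_disjoint_spanning_paths [Finite V] {G : SimpleGraph V} {A X : Finset V} (hAX : A ⊆ X)
    (hcard : #X + 1 ≤ 2 * #A) (j : ℕ)
    (hA : ∀ u ∈ A, #X + 4 * j ≤ 2 * G.degOn X u)
    (hX : ∀ u ∈ X, u ∉ A → #X + 2 * j + 2 ≤ G.degOn X u + #A)
    (a b : Fin j → V) (ha : ∀ i, a i ∈ X) (hb : ∀ i, b i ∈ X) (hab : ∀ i, a i ≠ b i) :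
    ∃ p : ∀ i, G.Walk (a i) (b i), (∀ i, (p i).IsPath ∧ (p i).support.toFinset = X) ∧
      ∀ i i', i ≠ i' → Disjoint (p i).edgeSet (p i').edgeSet := by
  induction j with
  | zero => exact ⟨fun i => i.elim0, fun i => i.elim0, fun i => i.elim0⟩
  | succ j ih =>
    obtain ⟨p, hp, hdisj⟩ := ih (fun u hu => by have := hA u hu; omega)
      (fun u hu hu' => by have := hX u hu hu'; omega) (fun i => a i.succ) (fun i => b i.succ)
      (fun i => ha _) (fun i => hb _) (fun i => hab _)
    set H := G.deleteEdges (⋃ i, (p i).edgeSet) with hH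
    -- Each path already chosen costs a vertex at most two neighbours, whence the `4 * j` and `2 *
    -- j` in the hypotheses.
    have hdeg : ∀ v, G.degOn X v ≤ H.degOn X v + j * 2 := fun v => by
      refine (degOn_le_add_degOn_fromEdgeSet G (⋃ i, (p i).edgeSet) X v).trans ?_
      gcongr
      simpa using degOn_fromEdgeSet_iUnion_le fun i => (hp i).1.degOn_fromEdgeSet_le X v
    obtain ⟨q, hq, hqX⟩ := (hasSpanningPath_of_degOn (G := H) hAX (ha 0) (hb 0) (hab 0)
      (fun u hu => by have := hA u hu; have := hdeg u; omega)
      (fun u hu hu' => by have := hX u hu hu'; have := hdeg u; omega) hcard).exists_isPath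
    have hle : H ≤ G := deleteEdges_le _
    have hq' : ∀ i, Disjoint (q.mapLe hle).edgeSet (p i).edgeSet := fun i => by
      rw [Set.disjoint_left]
      intro e he hep
      have he' : e ∈ q.edges := by simpa [Walk.edgeSet] using he
      have := q.edges_subset_edgeSet he'
      rw [hH, edgeSet_deleteEdges] at this
      exact this.2 (Set.mem_iUnion.2 ⟨i, hep⟩)
    refine ⟨Fin.cases (q.mapLe hle) p, fun i => ?_, fun i i' => ?_⟩
    · refine Fin.cases ?_ (fun i => ?_) i
      · simpa using ⟨hq, hqX⟩
      · simpa using hp i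
    · refine Fin.cases ?_ (fun i => ?_) i <;> refine Fin.cases ?_ (fun i' => ?_) i'
      · simp
      · simpa using fun _ => hq' i'
      · simpa using (hq' i).symm
      · simpa using hdisj i i'

/-- Two paths spanning complementary vertex sets, joined by two edges, form a Hamiltonian cycle. -/
theorem exists_isHamiltonianCycle_of_paths {G : SimpleGraph V} {X Y : Finset V}
    (hXY : Disjoint X Y) (hun : ∀ v, v ∈ X ∪ Y) {x₁ x₂ y₁ y₂ : V} {p : G.Walk x₁ x₂}
    {q : G.Walk y₁ y₂} (hp : p.IsPath) (hq : q.IsPath) (hpX : p.support.toFinset = X)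
    (hqY : q.support.toFinset = Y) (hx : x₁ ≠ x₂) (h₁ : G.Adj x₁ y₁) (h₂ : G.Adj x₂ y₂) :
    ∃ c : G.Walk y₁ y₁, c.IsHamiltonianCycle ∧
      ∀ e, e ∈ c.edgeSet ↔ e ∈ p.edges ∨ e ∈ q.edges ∨ e = s(x₁, y₁) ∨ e = s(x₂, y₂) := by
  have hdisj : ∀ v, v ∈ p.support → v ∉ q.support := fun v hvp hvq =>
    Finset.disjoint_left.1 hXY (hpX ▸ List.mem_toFinset.2 hvp) (hqY ▸ List.mem_toFinset.2 hvq)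
  have hmem : ∀ v, v ∈ p.support ∨ v ∈ q.support := fun v => by
    have := hun v
    rwa [mem_union, ← hpX, ← hqY, List.mem_toFinset, List.mem_toFinset] at this
  set r : G.Walk x₁ y₁ := p.append (Walk.cons h₂ q.reverse) with hr
  have hrs : r.support = p.support ++ q.support.reverse := by
    rw [hr, Walk.support_append]; simp
  have hrp : r.IsPath := by
    rw [Walk.isPath_def, hrs, List.nodup_append']
    exact ⟨hp.support_nodup, List.nodup_reverse.2 hq.support_nodup, fun v hv hv' =>
      hdisj v hv (List.mem_reverse.1 hv')⟩
  have hre : ∀ e, e ∈ r.edges ↔ e ∈ p.edges ∨ e = s(x₂, y₂) ∨ e ∈ q.edges := fun e => by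
    simp [hr, Walk.edges_append]
  have hcyc : (Walk.cons h₁.symm r).IsCycle := by
    rw [Walk.cons_isCycle_iff]
    refine ⟨hrp, fun h => ?_⟩
    rcases (hre _).1 h with h | h | h
    · exact hdisj _ (p.fst_mem_support_of_mem_edges h) q.start_mem_support
    · rw [Sym2.eq_iff] at h
      rcases h with ⟨h, -⟩ | ⟨-, h⟩
      · exact hdisj y₁ (h ▸ p.end_mem_support) q.start_mem_support
      · exact hx h
    · exact hdisj x₁ p.start_mem_support (q.snd_mem_support_of_mem_edges h)
  refine ⟨Walk.cons h₁.symm r,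
    Walk.isHamiltonianCycle_iff_isCycle_and_support_count_tail_eq_one.2 ⟨hcyc, ?_⟩, fun e => ?_⟩
  · have := hrp.isHamiltonian_of_mem (fun v => by
      rw [hrs, List.mem_append, List.mem_reverse]; exact hmem v)
    simpa [Walk.IsHamiltonian] using this
  · change e ∈ (Walk.cons h₁.symm r).edges ↔ _
    rw [Walk.edges_cons, List.mem_cons, hre, Sym2.eq_swap (a := y₁)]
    tauto

end SimpleGraph

/-! ### Kőnig's theorem -/

namespace SimpleGraph

variable {V : Type*} [DecidableEq V]

/-- `C` meets every edge of `G` between `X` and `Y`. -/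
def CoversBetween (G : SimpleGraph V) (X Y C : Finset V) : Prop :=
  ∀ x ∈ X, ∀ y ∈ Y, G.Adj x y → x ∈ C ∨ y ∈ C

omit [DecidableEq V] in
theorem CoversBetween.symm {G : SimpleGraph V} {X Y C : Finset V} (h : G.CoversBetween X Y C) :
    G.CoversBetween Y X C :=
  fun y hy x hx hyx => (h x hx y hy hyx.symm).symm

/-- Hall's condition holds: if `W ⊆ C ∩ X` had fewer than `#W` neighbours in `Y \ C`, exchanging `W`
for them would give a smaller cover. -/
theorem exists_injOn_of_minimal_cover {G : SimpleGraph V} {X Y C : Finset V}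
    (hC : G.CoversBetween X Y C) (hmin : ∀ D, G.CoversBetween X Y D → #C ≤ #D)
    (hXY : Disjoint X Y) :
    ∃ f : V → V, Set.InjOn f (C ∩ X : Finset V) ∧
      ∀ x ∈ C ∩ X, f x ∈ Y ∧ f x ∉ C ∧ G.Adj x (f x) := by
  classical
  let t : {x // x ∈ C ∩ X} → Finset V := fun x => {y ∈ Y | y ∉ C ∧ G.Adj x y}
  obtain ⟨f, hf, hft⟩ := (Finset.all_card_le_biUnion_card_iff_exists_injective t).1 (by
    intro s
    set W : Finset V := s.map (Function.Embedding.subtype _) with hW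
    have hWC : W ⊆ C := by
      intro w hw
      simp only [hW, mem_map, Function.Embedding.coe_subtype] at hw
      obtain ⟨z, -, rfl⟩ := hw
      exact (mem_inter.1 z.2).1
    have hcov : G.CoversBetween X Y ((C \ W) ∪ s.biUnion t) := by
      intro x hx y hy hxy
      by_cases hyC : y ∈ C
      · right
        refine mem_union_left _ (mem_sdiff.2 ⟨hyC, fun hyW => ?_⟩)
        simp only [hW, mem_map, Function.Embedding.coe_subtype] at hyW
        obtain ⟨z, -, rfl⟩ := hyW
        exact Finset.disjoint_left.1 hXY (mem_inter.1 z.2).2 hy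
      · have hxC := (hC x hx y hy hxy).resolve_right hyC
        by_cases hxW : x ∈ W
        · right
          refine mem_union_right _ (mem_biUnion.2 ?_)
          simp only [hW, mem_map, Function.Embedding.coe_subtype] at hxW
          obtain ⟨z, hz, rfl⟩ := hxW
          exact ⟨z, hz, by simp [t, hy, hyC, hxy]⟩
        · exact Or.inl (mem_union_left _ (mem_sdiff.2 ⟨hxC, hxW⟩))
    have h1 := hmin _ hcov
    have h2 := card_union_le (C \ W) (s.biUnion t)
    have h3 := card_sdiff_add_card_eq_card hWC
    have h4 : #W = #s := card_map _
    omega)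
  refine ⟨fun x => if hx : x ∈ C ∩ X then f ⟨x, hx⟩ else x, ?_, ?_⟩
  · intro x hx y hy hxy
    rw [mem_coe] at hx hy
    simp only [hx, hy, dite_true] at hxy
    simpa using hf hxy
  · intro x hx
    have := hft ⟨x, hx⟩
    simp only [t, mem_filter] at this
    simpa only [hx, dite_true] using this

/-- **Kőnig's theorem**: if every set covering the edges between `X` and `Y` has at least `k`
vertices, there is a matching of `k` edges between `X` and `Y`. -/
theorem exists_matching_of_le_card_cover {G : SimpleGraph V} {X Y : Finset V} {k : ℕ}
    (hXY : Disjoint X Y) (hk : ∀ C, G.CoversBetween X Y C → k ≤ #C) :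
    ∃ f g : Fin k → V, f.Injective ∧ g.Injective ∧
      ∀ i, f i ∈ X ∧ g i ∈ Y ∧ G.Adj (f i) (g i) := by
  classical
  have hex : ∃ n, ∃ C, G.CoversBetween X Y C ∧ #C = n :=
    ⟨_, X, fun x hx _ _ _ => Or.inl hx, rfl⟩
  obtain ⟨C, hC, hCn⟩ := Nat.find_spec hex
  have hmin : ∀ D, G.CoversBetween X Y D → #C ≤ #D := fun D hD => by
    rw [hCn]; exact Nat.find_min' hex ⟨D, hD, rfl⟩
  have hCXY : ∀ c ∈ C, c ∉ X → c ∈ Y := by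
    intro c hc hcX
    by_contra hcY
    have : G.CoversBetween X Y (C.erase c) := by
      intro x hx y hy hxy
      rcases hC x hx y hy hxy with h | h
      · exact Or.inl (mem_erase.2 ⟨by rintro rfl; exact hcX hx, h⟩)
      · exact Or.inr (mem_erase.2 ⟨by rintro rfl; exact hcY hy, h⟩)
    have h1 := hmin _ this
    have h2 := card_erase_lt_of_mem hc
    omega
  obtain ⟨f, hf, hf'⟩ := exists_injOn_of_minimal_cover hC hmin hXY
  obtain ⟨g, hg, hg'⟩ := exists_injOn_of_minimal_cover hC.symm
    (fun D hD => hmin D hD.symm) hXY.symm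
  obtain ⟨D, hDC, hDk⟩ := exists_subset_card_eq (hk C hC)
  let e : Fin k ≃ D := (finCongr hDk.symm).trans D.equivFin.symm
  have heC : ∀ i, (e i : V) ∈ C := fun i => hDC (e i).2
  have heinj : ∀ i j, (e i : V) = e j → i = j := fun i j h => e.injective (Subtype.ext h)
  -- Each chosen vertex of the minimum cover is matched to a vertex outside the cover. Thus an end
  -- in `C` never coincides with a partner, and the two partial matchings fit together.
  refine ⟨fun i => if (e i : V) ∈ X then e i else g (e i),
    fun i => if (e i : V) ∈ X then f (e i) else e i, ?_, ?_, ?_⟩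
  · intro i j hij
    by_cases hi : (e i : V) ∈ X <;> by_cases hj : (e j : V) ∈ X <;>
      simp only [hi, hj, if_true, if_false] at hij
    · exact heinj i j hij
    · exact absurd (hij ▸ heC i) (hg' _ (mem_inter.2 ⟨heC j, hCXY _ (heC j) hj⟩)).2.1
    · exact absurd (hij ▸ heC j) (hg' _ (mem_inter.2 ⟨heC i, hCXY _ (heC i) hi⟩)).2.1
    · exact heinj i j (hg (by simpa using ⟨heC i, hCXY _ (heC i) hi⟩)
        (by simpa using ⟨heC j, hCXY _ (heC j) hj⟩) hij)
  · intro i j hij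
    by_cases hi : (e i : V) ∈ X <;> by_cases hj : (e j : V) ∈ X <;>
      simp only [hi, hj, if_true, if_false] at hij
    · exact heinj i j (hf (by simpa using ⟨heC i, hi⟩) (by simpa using ⟨heC j, hj⟩) hij)
    · exact absurd (hij ▸ heC j) (hf' _ (mem_inter.2 ⟨heC i, hi⟩)).2.1
    · exact absurd (hij ▸ heC i) (hf' _ (mem_inter.2 ⟨heC j, hj⟩)).2.1
    · exact heinj i j hij
  · intro i
    by_cases hi : (e i : V) ∈ X
    · have := hf' _ (mem_inter.2 ⟨heC i, hi⟩)
      simp only [hi, if_true]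
      exact ⟨trivial, this.1, this.2.2⟩
    · have hY := hCXY _ (heC i) hi
      have := hg' _ (mem_inter.2 ⟨heC i, hY⟩)
      simp only [hi, if_false]
      exact ⟨this.1, hY, this.2.2.symm⟩

/-! ### Pairs of crossing edges -/

/-- Two disjoint edges of `G` between `X` and `Y`, the first of which leaves `X` at `x₁`. -/
structure CrossingPair (G : SimpleGraph V) (X Y : Finset V) where
  (x₁ x₂ y₁ y₂ : V)
  x₁_mem : x₁ ∈ X
  x₂_mem : x₂ ∈ X
  y₁_mem : y₁ ∈ Y
  y₂_mem : y₂ ∈ Y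
  x_ne : x₁ ≠ x₂
  y_ne : y₁ ≠ y₂
  adj₁ : G.Adj x₁ y₁
  adj₂ : G.Adj x₂ y₂

namespace CrossingPair

variable {G : SimpleGraph V} {X Y : Finset V}

/-- The two edges of a crossing pair. -/
def edges (c : CrossingPair G X Y) : Finset (Sym2 V) := {s(c.x₁, c.y₁), s(c.x₂, c.y₂)}

/-- The four ends of a crossing pair. -/
def verts (c : CrossingPair G X Y) : Finset V := {c.x₁, c.x₂, c.y₁, c.y₂}

/-- Every edge of the pair has an end outside `U`. -/
def Avoids (c : CrossingPair G X Y) (U : Finset V) : Prop :=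
  (c.x₁ ∉ U ∨ c.y₁ ∉ U) ∧ (c.x₂ ∉ U ∨ c.y₂ ∉ U)

/-- Exchange the roles of `X` and `Y`. -/
def swap (c : CrossingPair G X Y) : CrossingPair G Y X where
  x₁ := c.y₁
  x₂ := c.y₂
  y₁ := c.x₁
  y₂ := c.x₂
  x₁_mem := c.y₁_mem
  x₂_mem := c.y₂_mem
  y₁_mem := c.x₁_mem
  y₂_mem := c.x₂_mem
  x_ne := c.y_ne
  y_ne := c.x_ne
  adj₁ := c.adj₁.symm
  adj₂ := c.adj₂.symm

theorem edges_swap (c : CrossingPair G X Y) : c.swap.edges = c.edges := by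
  simp [edges, swap, Sym2.eq_swap]

omit [DecidableEq V] in
theorem Avoids.swap {c : CrossingPair G X Y} {U : Finset V} (h : c.Avoids U) :
    c.swap.Avoids U :=
  ⟨h.1.symm, h.2.symm⟩

omit [DecidableEq V] in
theorem Avoids.mono {c : CrossingPair G X Y} {U W : Finset V} (h : c.Avoids W) (hU : U ⊆ W) :
    c.Avoids U :=
  ⟨h.1.imp (fun h h' => h (hU h')) (fun h h' => h (hU h')),
    h.2.imp (fun h h' => h (hU h')) (fun h h' => h (hU h'))⟩

theorem Avoids.disjoint_edges {c : CrossingPair G X Y} {U : Finset V} (h : c.Avoids U)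
    {E : Finset (Sym2 V)} (hE : ∀ e ∈ E, ∀ v ∈ e, v ∈ U) : Disjoint E c.edges := by
  rw [Finset.disjoint_left]
  intro e he hec
  simp only [edges, mem_insert, mem_singleton] at hec
  rcases hec with rfl | rfl
  · exact h.1.elim (· (hE _ he _ (by simp))) (· (hE _ he _ (by simp)))
  · exact h.2.elim (· (hE _ he _ (by simp))) (· (hE _ he _ (by simp)))

theorem mem_verts_of_mem_edges (c : CrossingPair G X Y) :
    ∀ e ∈ c.edges, ∀ v ∈ e, v ∈ c.verts := by
  intro e he v hv
  simp only [edges, mem_insert, mem_singleton] at he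
  rcases he with rfl | rfl <;> rw [Sym2.mem_iff] at hv <;>
    rcases hv with rfl | rfl <;> simp [verts]

theorem card_verts_inter_left (c : CrossingPair G X Y) (hXY : Disjoint X Y) :
    #(c.verts ∩ X) ≤ 2 := by
  refine (card_le_card (t := {c.x₁, c.x₂}) fun v hv => ?_).trans card_le_two
  simp only [verts, mem_inter, mem_insert, mem_singleton] at hv ⊢
  obtain ⟨rfl | rfl | rfl | rfl, hv⟩ := hv
  · simp
  · simp
  · exact absurd c.y₁_mem (Finset.disjoint_left.1 hXY hv)
  · exact absurd c.y₂_mem (Finset.disjoint_left.1 hXY hv)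

theorem card_verts_inter_right (c : CrossingPair G X Y) (hXY : Disjoint X Y) :
    #(c.verts ∩ Y) ≤ 2 := by
  have := c.swap.card_verts_inter_left hXY.symm
  convert this using 3
  ext; simp [verts, swap]; tauto

end CrossingPair

/-- Two vertices of `X \ U` can be given distinct neighbours in `Y`; this serves when `X` is
strictly the smaller class. -/
theorem exists_crossingPair_of_two_le {G : SimpleGraph V} {X Y U : Finset V}
    (hdeg : ∀ x ∈ X, 2 ≤ G.degOn Y x) (hU : #(U ∩ X) + 2 ≤ #X) :
    ∃ c : CrossingPair G X Y, c.Avoids U := by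
  classical
  have h1 : 1 < #(X \ U) := by
    rw [card_sdiff]; omega
  obtain ⟨x, hx, x', hx', hne⟩ := one_lt_card.1 h1
  rw [mem_sdiff] at hx hx'
  obtain ⟨y, hy⟩ : ({w ∈ Y | G.Adj x w}).Nonempty := by
    rw [← card_pos]; exact lt_of_lt_of_le (by norm_num) (hdeg x hx.1)
  obtain ⟨y', hy', hyne⟩ := exists_mem_ne (s := ({w ∈ Y | G.Adj x' w}))
    (lt_of_lt_of_le (by norm_num) (hdeg x' hx'.1)) y
  rw [mem_filter] at hy hy'
  exact ⟨⟨x, x', y, y', hx.1, hx'.1, hy.1, hy'.1, hne, hyne.symm, hy.2, hy'.2⟩,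
    Or.inl hx.2, Or.inl hx'.2⟩

/-- This serves for classes of equal size. If the edges found from `X \ U` and from `Y \ U` share
their end `x` in `X`, an edge `zw` at a second vertex of `X \ U` is disjoint from one of them. -/
theorem exists_crossingPair_of_one_le {G : SimpleGraph V} {X Y U : Finset V}
    (hX : ∀ x ∈ X, 1 ≤ G.degOn Y x) (hY : ∀ y ∈ Y, 1 ≤ G.degOn X y)
    (hUX : #(U ∩ X) + 2 ≤ #X) (hUY : #(U ∩ Y) + 2 ≤ #Y) :
    ∃ c : CrossingPair G X Y, c.Avoids U := by
  classical
  have hnX : ∀ x ∈ X, ∃ y ∈ Y, G.Adj x y := fun x hx => by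
    obtain ⟨y, hy⟩ := card_pos.1 (hX x hx)
    exact ⟨y, by simpa using hy⟩
  have hnY : ∀ y ∈ Y, ∃ x ∈ X, G.Adj x y := fun y hy => by
    obtain ⟨x, hx⟩ := card_pos.1 (hY y hy)
    exact ⟨x, by simpa [G.adj_comm] using hx⟩
  have h1 : 1 < #(X \ U) := by rw [card_sdiff]; omega
  have h2 : 1 < #(Y \ U) := by rw [card_sdiff]; omega
  obtain ⟨x, hx, z, hz, hne⟩ := one_lt_card.1 h1
  rw [mem_sdiff] at hx hz
  obtain ⟨y, hy, hxy⟩ := hnX x hx.1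
  obtain ⟨y', hy', hyne⟩ := exists_mem_ne h2 y
  rw [mem_sdiff] at hy'
  obtain ⟨x', hx', hxy'⟩ := hnY y' hy'.1
  by_cases hxx : x' = x
  · subst hxx
    obtain ⟨w, hw, hzw⟩ := hnX z hz.1
    by_cases hwy : w = y'
    · subst hwy
      exact ⟨⟨x', z, y, w, hx.1, hz.1, hy, hw, hne, hyne.symm, hxy, hzw⟩,
        Or.inl hx.2, Or.inl hz.2⟩
    · exact ⟨⟨x', z, y', w, hx.1, hz.1, hy'.1, hw, hne, Ne.symm hwy, hxy', hzw⟩,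
        Or.inr hy'.2, Or.inl hz.2⟩
  · exact ⟨⟨x, x', y, y', hx.1, hx', hy, hy'.1, Ne.symm hxx, hyne.symm, hxy, hxy'⟩,
      Or.inl hx.2, Or.inr hy'.2⟩

/-- Crossing pairs can be chosen greedily. -/
theorem exists_disjoint_crossingPairs {G : SimpleGraph V} {X Y : Finset V} (hXY : Disjoint X Y)
    (h : ∀ U : Finset V, #(U ∩ X) + 2 ≤ #X → #(U ∩ Y) + 2 ≤ #Y →
      ∃ c : CrossingPair G X Y, c.Avoids U)
    (j : ℕ) (U : Finset V) (hUX : #(U ∩ X) + 2 * j ≤ #X) (hUY : #(U ∩ Y) + 2 * j ≤ #Y) :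
    ∃ c : Fin j → CrossingPair G X Y, (∀ i, (c i).Avoids U) ∧
      ∀ i i', i ≠ i' → Disjoint (c i).edges (c i').edges := by
  induction j generalizing U with
  | zero => exact ⟨Fin.elim0, fun i => i.elim0, fun i => i.elim0⟩
  | succ j ih =>
    obtain ⟨c₀, hc₀⟩ := h U (by omega) (by omega)
    have hle : ∀ Z, #((U ∪ c₀.verts) ∩ Z) ≤ #(U ∩ Z) + #(c₀.verts ∩ Z) := fun Z => by
      rw [union_inter_distrib_right]; exact card_union_le _ _
    have h1 := hle X
    have h2 := hle Y
    have h3 := c₀.card_verts_inter_left hXY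
    have h4 := c₀.card_verts_inter_right hXY
    -- Forbidding the four ends of `c₀` costs two vertices per class and makes later pairs
    -- edge-disjoint from `c₀`.
    obtain ⟨c, hc, hdisj⟩ := ih (U ∪ c₀.verts) (by omega) (by omega)
    have hc' : ∀ i, Disjoint c₀.edges (c i).edges := fun i =>
      ((hc i).mono subset_union_right).disjoint_edges c₀.mem_verts_of_mem_edges
    refine ⟨Fin.cons c₀ c, fun i => ?_, fun i i' => ?_⟩
    · refine Fin.cases ?_ (fun i => ?_) i
      · simpa using hc₀
      · simpa using (hc i).mono subset_union_left
    · refine Fin.cases ?_ (fun i => ?_) i <;> refine Fin.cases ?_ (fun i' => ?_) i'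
      · simp
      · simpa using fun _ => hc' i'
      · simpa using (hc' i).symm
      · simpa using hdisj i i'

/-- If the minimum degree is at least half the order, crossing pairs avoiding any fixed small set
exist for every partition into two classes. -/
theorem exists_disjoint_crossingPairs_of_partition [Fintype V] {G : SimpleGraph V}
    {X Y : Finset V} (hXY : Disjoint X Y) (hun : X ∪ Y = univ)
    (hdeg : ∀ v, Fintype.card V ≤ 2 * G.degOn univ v)
    (j : ℕ) (U : Finset V) (hUX : #(U ∩ X) + 2 * j ≤ #X) (hUY : #(U ∩ Y) + 2 * j ≤ #Y) :
    ∃ c : Fin j → CrossingPair G X Y, (∀ i, (c i).Avoids U) ∧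
      ∀ i i', i ≠ i' → Disjoint (c i).edges (c i').edges := by
  classical
  wlog hle : #X ≤ #Y generalizing X Y
  · obtain ⟨c, hc, hd⟩ := this hXY.symm (by rw [union_comm, hun]) hUY hUX (by omega)
    exact ⟨fun i => (c i).swap, fun i => (hc i).swap, fun i i' h => by
      simpa [CrossingPair.edges_swap] using hd i i' h⟩
  have hcard : #X + #Y = Fintype.card V := by
    rw [← card_union_of_disjoint hXY, hun, card_univ]
  have hsplit : ∀ v, G.degOn univ v ≤ G.degOn X v + G.degOn Y v := fun v => by
    rw [degOn, ← hun, filter_union]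
    exact card_union_le _ _
  have hself : ∀ Z : Finset V, ∀ v ∈ Z, G.degOn Z v + 1 ≤ #Z := fun Z v hv => by
    rw [← card_erase_add_one hv]
    gcongr
    refine card_le_card fun w hw => ?_
    rw [mem_filter] at hw
    exact mem_erase.2 ⟨hw.2.ne', hw.1⟩
  refine exists_disjoint_crossingPairs hXY (fun U hX hY => ?_) j U hUX hUY
  -- A vertex `x` has at most `#X - 1` neighbours in `X`. With degree at least `n/2`, this leaves
  -- two in `Y` if `#X < n/2` and one if `#X = n/2`.
  rcases hle.lt_or_eq with hlt | heq
  · refine exists_crossingPair_of_two_le (fun x hx => ?_) hX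
    have := hself X x hx
    have := hsplit x
    have := hdeg x
    omega
  · refine exists_crossingPair_of_one_le (fun x hx => ?_) (fun y hy => ?_) hX hY
    · have := hself X x hx
      have := hsplit x
      have := hdeg x
      omega
    · have := hself Y y hy
      have := hsplit y
      have := hdeg y
      omega

end SimpleGraph

/-! ### Robust sides -/

namespace SimpleGraph

variable {V : Type*} [DecidableEq V]

omit [DecidableEq V] in
theorem Reachable.mem_of_forall_adj {G : SimpleGraph V} {Z : Set V}
    (h : ∀ u v, G.Adj u v → u ∈ Z → v ∈ Z) {u v : V} (huv : G.Reachable u v) (hu : u ∈ Z) :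
    v ∈ Z := by
  obtain ⟨p⟩ := huv
  induction p with
  | nil => exact hu
  | cons hadj _ ih => exact ih (h _ _ hadj hu)

theorem degOn_union_le (G : SimpleGraph V) (Z W : Finset V) (v : V) :
    G.degOn (Z ∪ W) v ≤ G.degOn Z v + G.degOn W v := by
  classical
  simp only [degOn, filter_union]
  exact card_union_le _ _

omit [DecidableEq V] in
theorem degOn_le_card (G : SimpleGraph V) (Z : Finset V) (v : V) : G.degOn Z v ≤ #Z := by
  classical
  exact card_filter_le _ _

theorem degOn_add_one_le_card (G : SimpleGraph V) {Z : Finset V} {v : V} (hv : v ∈ Z) :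
    G.degOn Z v + 1 ≤ #Z := by
  classical
  rw [← card_erase_add_one hv]
  gcongr
  refine card_le_card fun w hw => ?_
  rw [mem_filter] at hw
  exact mem_erase.2 ⟨hw.2.ne', hw.1⟩

/-- `X` is a vertex set on which `G` is dense: it has a large core `A` of vertices of high degree
in `X`, and the few other vertices have several neighbours in `A`. The parameters are such that
`ℓ` Hamiltonian cycles and fewer than `k` vertices can be removed. -/
structure IsRobustSide (G : SimpleGraph V) (k ℓ : ℕ) (A X : Finset V) : Prop where
  subset : A ⊆ X
  nonempty : A.Nonempty
  card_lt : #X < #A + k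
  card_le : #X + 1 ≤ 2 * #A
  le_degOn : ∀ u ∈ A, #X + 4 * ℓ + k ≤ 2 * G.degOn X u + 2
  le_degOn_core : ∀ u ∈ X, u ∉ A → 2 * ℓ + k + 1 ≤ G.degOn A u

namespace IsRobustSide

variable {G : SimpleGraph V} {k ℓ : ℕ} {A X : Finset V}

theorem le_card (h : G.IsRobustSide k ℓ A X) : k + 4 * ℓ ≤ #X := by
  obtain ⟨u, hu⟩ := h.nonempty
  have := h.le_degOn u hu
  have := G.degOn_add_one_le_card (h.subset hu)
  omega

theorem exists_spanning_paths [Finite V] (h : G.IsRobustSide k ℓ A X) (hk : 2 ≤ k)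
    (a b : Fin ℓ → V) (ha : ∀ i, a i ∈ X) (hb : ∀ i, b i ∈ X) (hab : ∀ i, a i ≠ b i) :
    ∃ p : ∀ i, G.Walk (a i) (b i), (∀ i, (p i).IsPath ∧ (p i).support.toFinset = X) ∧
      ∀ i i', i ≠ i' → Disjoint (p i).edgeSet (p i').edgeSet := by
  refine exists_disjoint_spanning_paths h.subset h.card_le ℓ (fun u hu => ?_)
    (fun u hu hu' => ?_) a b ha hb hab
  · have := h.le_degOn u hu
    omega
  · have := h.le_degOn_core u hu hu'
    have := G.degOn_mono_right h.subset u
    have := h.card_lt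
    omega

/-- Nonadjacent core vertices keep a common neighbour, and every other vertex of `X` keeps a
neighbour in the core. -/
theorem reachable (h : G.IsRobustSide k ℓ A X) {H : SimpleGraph V}
    (hH : ∀ Z v, G.degOn Z v ≤ H.degOn Z v + 2 * ℓ) {T : Finset V} (hT : #T < k)
    (u v : {v : V | v ∉ T}) (hu : (u : V) ∈ X) (hv : (v : V) ∈ X) :
    (H.induce {v : V | v ∉ T}).Reachable u v := by
  classical
  have hsplit : ∀ Z w, H.degOn Z w ≤ H.degOn (Z \ T) w + #(T ∩ Z) := fun Z w => by
    have h1 : Z = (Z \ T) ∪ (T ∩ Z) := by ext; simp; tauto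
    have h2 := H.degOn_union_le (Z \ T) (T ∩ Z) w
    rw [← h1] at h2
    exact h2.trans (Nat.add_le_add_left (H.degOn_le_card _ _) _)
  have hTle : ∀ Z, #(T ∩ Z) ≤ #T := fun Z => card_le_card inter_subset_left
  have core : ∀ u v : {v : V | v ∉ T}, (u : V) ∈ A → (v : V) ∈ A →
      (H.induce {v : V | v ∉ T}).Reachable u v := by
    intro u v hu hv
    by_cases huv : u = v
    · rw [huv]
    by_cases hadj : H.Adj u v
    · exact Adj.reachable (by simpa using hadj)
    have huv' : (u : V) ≠ v := fun h => huv (Subtype.ext h)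
    -- Let `t = #(T ∩ X)`. The degrees into `X \ T` sum to at least `#X + k - 2 - 2t`, while the
    -- union of the neighbourhoods misses `u` and `v`, so has at most `#X - t - 2` vertices. At
    -- least `k - t > 0` are common.
    have hne : (({w ∈ X \ T | H.Adj u w}) ∩ ({w ∈ X \ T | H.Adj v w})).Nonempty := by
      rw [← card_pos]
      have h1 := card_union_add_card_inter ({w ∈ X \ T | H.Adj u w}) ({w ∈ X \ T | H.Adj v w})
      have h2 : #({w ∈ X \ T | H.Adj u w} ∪ {w ∈ X \ T | H.Adj v w})
          ≤ #(((X \ T).erase u).erase v) := by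
        refine card_le_card fun w hw => ?_
        simp only [mem_union, mem_filter] at hw
        simp only [mem_erase]
        refine ⟨?_, ?_, ?_⟩
        · rintro rfl
          rcases hw with hw | hw
          · exact hadj hw.2
          · exact H.loopless.irrefl _ hw.2
        · rintro rfl
          rcases hw with hw | hw
          · exact H.loopless.irrefl _ hw.2
          · exact hadj hw.2.symm
        · tauto
      have hu2 : (u : V) ∈ X \ T := mem_sdiff.2 ⟨h.subset hu, u.2⟩
      have hv2 : (v : V) ∈ (X \ T).erase u :=
        mem_erase.2 ⟨huv'.symm, mem_sdiff.2 ⟨h.subset hv, v.2⟩⟩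
      have h3 := card_erase_add_one hv2
      have h4 := card_erase_add_one hu2
      have h5 : #(X \ T) + #(T ∩ X) = #X := by
        rw [inter_comm]; exact card_sdiff_add_card_inter X T
      have h6 := h.le_degOn _ hu
      have h7 := h.le_degOn _ hv
      have h8 := hH X u
      have h9 := hH X v
      have h10 := hsplit X u
      have h11 := hsplit X v
      have h12 := hTle X
      have h13 : H.degOn (X \ T) u = #({w ∈ X \ T | H.Adj u w}) := by rw [degOn]
      have h14 : H.degOn (X \ T) v = #({w ∈ X \ T | H.Adj v w}) := by rw [degOn]
      omega
    obtain ⟨w, hw⟩ := hne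
    simp only [mem_inter, mem_filter, mem_sdiff] at hw
    let w' : {v : V | v ∉ T} := ⟨w, hw.1.1.2⟩
    have h1 : (H.induce {v : V | v ∉ T}).Adj u w' := by simpa using hw.1.2
    have h2 : (H.induce {v : V | v ∉ T}).Adj v w' := by simpa using hw.2.2
    exact h1.reachable.trans h2.symm.reachable
  have toCore : ∀ u : {v : V | v ∉ T}, (u : V) ∈ X → ∃ a : {v : V | v ∉ T}, (a : V) ∈ A ∧
      (H.induce {v : V | v ∉ T}).Reachable u a := by
    intro u hu
    by_cases huA : (u : V) ∈ A
    · exact ⟨u, huA, Reachable.refl u⟩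
    have hpos : 0 < H.degOn (A \ T) u := by
      have := h.le_degOn_core u hu huA
      have := hH A u
      have := hsplit A u
      have := hTle A
      omega
    obtain ⟨w, hw⟩ := card_pos.1 hpos
    simp only [mem_filter, mem_sdiff] at hw
    refine ⟨⟨w, hw.1.2⟩, hw.1.1, Adj.reachable ?_⟩
    simpa using hw.2
  obtain ⟨a, ha, hua⟩ := toCore u hu
  obtain ⟨b, hb, hvb⟩ := toCore v hv
  exact hua.trans ((core a b ha hb).trans hvb.symm)

end IsRobustSide

/-! ### From a small separator to a robust partition -/

theorem exists_separation_of_not_isKConnected [Fintype V] {G : SimpleGraph V} {k : ℕ}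
    (hk : k < Fintype.card V) (h : ¬ G.IsKConnected k) :
    ∃ S A B : Finset V, #S < k ∧ A.Nonempty ∧ B.Nonempty ∧ Disjoint A B ∧ Disjoint S (A ∪ B) ∧
      S ∪ (A ∪ B) = univ ∧ ∀ a ∈ A, ∀ b ∈ B, ¬ G.Adj a b := by
  classical
  rw [IsKConnected] at h
  push Not at h
  obtain ⟨S, hS, hcon⟩ := h hk
  have hne : Nonempty {v : V | v ∉ S} := by
    by_contra hno
    have : S = univ := by
      ext v
      by_contra hv
      exact hno ⟨⟨v, by simpa using hv⟩⟩
    rw [this, card_univ] at hS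
    omega
  rw [connected_iff, not_and'] at hcon
  have hpre := hcon hne
  rw [Preconnected] at hpre
  push Not at hpre
  obtain ⟨u, v, huv⟩ := hpre
  -- The component of `u` after deleting `S`; the other class consists of all remaining vertices
  -- outside `S`.
  let A : Finset V := {w | ∃ hw : w ∉ S, (G.induce {v : V | v ∉ S}).Reachable u ⟨w, hw⟩}
  have hAS : ∀ a ∈ A, a ∉ S := fun a ha => by
    simp only [A, mem_filter, mem_univ, true_and] at ha
    exact ha.1
  refine ⟨S, A, univ \ (S ∪ A), hS, ⟨u, ?_⟩, ⟨v, ?_⟩, ?_, ?_, ?_, ?_⟩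
  · simp only [A, mem_filter, mem_univ, true_and]
    exact ⟨u.2, Reachable.refl _⟩
  · simp only [A, mem_filter, mem_univ, true_and, mem_sdiff, mem_union, not_or, not_exists]
    exact ⟨v.2, fun _ => huv⟩
  · rw [Finset.disjoint_left]
    intro a ha
    simp [ha]
  · rw [Finset.disjoint_left]
    intro a ha
    simp only [mem_union, mem_sdiff, mem_univ, true_and, not_or]
    exact ⟨fun h => hAS a h ha, fun h => h.1 ha⟩
  · ext w
    simp only [mem_union, mem_sdiff, mem_univ, true_and]
    tauto
  · intro a ha b hb hab
    simp only [mem_sdiff, mem_univ, true_and, mem_union, not_or] at hb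
    refine hb.2 ?_
    simp only [A, mem_filter, mem_univ, true_and] at ha ⊢
    obtain ⟨haS, ha⟩ := ha
    refine ⟨hb.1, ha.trans (Adj.reachable ?_)⟩
    simpa using hab

theorem isRobustSide_of_separation [Fintype V] {G : SimpleGraph V} {k ℓ : ℕ} {A B P Q : Finset V}
    (hk : 2 ≤ k) (hℓ : 2 ≤ ℓ) (hn : 6 * k + 20 * ℓ ≤ Fintype.card V + 10)
    (hdeg : ∀ v, Fintype.card V ≤ 2 * G.degOn univ v)
    (hA : A.Nonempty) (hB : B.Nonempty) (hun : A ∪ P ∪ (B ∪ Q) = univ)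
    (hcard : #A + #P + (#B + #Q) = Fintype.card V) (hPQ : #P + #Q < k)
    (hAP : #(A ∪ P) = #A + #P)
    (hAB : ∀ a ∈ A, G.degOn B a ≤ 2 * ℓ) (hBA : ∀ b ∈ B, G.degOn A b ≤ 2 * ℓ)
    (hP : ∀ x ∈ P, G.degOn B x ≤ G.degOn A x) :
    G.IsRobustSide k ℓ A (A ∪ P) := by
  have hsplit : ∀ v, G.degOn univ v ≤ G.degOn (A ∪ P) v + (G.degOn B v + #Q) := fun v => by
    rw [← hun]
    refine (G.degOn_union_le _ _ _).trans (Nat.add_le_add_left ?_ _)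
    exact (G.degOn_union_le _ _ _).trans (Nat.add_le_add_left (G.degOn_le_card _ _) _)
  have hsplit' : ∀ v, G.degOn (A ∪ P) v ≤ G.degOn A v + #P := fun v =>
    (G.degOn_union_le _ _ _).trans (Nat.add_le_add_left (G.degOn_le_card _ _) _)
  -- The `n/2` neighbours of a vertex of `B` include at most `2ℓ` in `A` and `#B - 1` in `B`.
  have cardB : Fintype.card V + 2 ≤ 2 * (2 * ℓ + #B + #P + #Q) := by
    obtain ⟨b, hb⟩ := hB
    have := hdeg b
    have := hsplit b
    have := hsplit' b
    have := hBA b hb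
    have := G.degOn_add_one_le_card hb
    omega
  have cardA : Fintype.card V + 2 ≤ 2 * (2 * ℓ + #A + #P + #Q) := by
    obtain ⟨b, hb⟩ := hA
    have := hdeg b
    have := hsplit b
    have := hsplit' b
    have := hAB b hb
    have := G.degOn_add_one_le_card hb
    omega
  refine ⟨subset_union_left, hA, by omega, by omega, fun u hu => ?_, fun u hu hu' => ?_⟩
  -- Here `2 deg(u) ≥ n - 4ℓ - 2#Q` within `X`, and `cardB` gives `#X ≤ n/2 + 2ℓ + #P - 1`. Since
  -- `#P + 2#Q ≤ 2(k - 1)`, the required inequality follows from exactly `n ≥ 6k + 20ℓ - 10`.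
  · have := hdeg u
    have := hsplit u
    have := hAB u hu
    omega
  -- By `hP`, at least half of the neighbours of `u` outside the separator lie in `A`.
  · have huP : u ∈ P := (mem_union.1 hu).resolve_left hu'
    have := hdeg u
    have := hsplit u
    have := hsplit' u
    have := hP u huP
    omega

/-- If removing `ℓ` Hamiltonian cycles destroys `k`-connectedness, then `G` splits into two robust
sides. -/
theorem exists_robust_partition [Fintype V] {G H : SimpleGraph V} {k ℓ : ℕ}
    (hk : 2 ≤ k) (hℓ : 2 ≤ ℓ) (hn : 6 * k + 20 * ℓ ≤ Fintype.card V + 10)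
    (hdeg : ∀ v, Fintype.card V ≤ 2 * G.degOn univ v)
    (hH : ∀ Z v, G.degOn Z v ≤ H.degOn Z v + 2 * ℓ) (hcon : ¬ H.IsKConnected k) :
    ∃ A X B Y : Finset V, Disjoint X Y ∧ X ∪ Y = univ ∧ G.IsRobustSide k ℓ A X ∧
      G.IsRobustSide k ℓ B Y := by
  classical
  obtain ⟨S, A, B, hS, hA, hB, hAB, hSAB, hun, hadj⟩ :=
    exists_separation_of_not_isKConnected (by omega) hcon
  have hzero : ∀ a ∈ A, H.degOn B a = 0 := fun a ha => by
    rw [degOn, card_eq_zero, filter_eq_empty_iff]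
    exact hadj a ha
  have hzero' : ∀ b ∈ B, H.degOn A b = 0 := fun b hb => by
    rw [degOn, card_eq_zero, filter_eq_empty_iff]
    exact fun a ha h => hadj a ha b hb h.symm
  have hA' : ∀ a ∈ A, G.degOn B a ≤ 2 * ℓ := fun a ha => by
    simpa [hzero a ha] using hH B a
  have hB' : ∀ b ∈ B, G.degOn A b ≤ 2 * ℓ := fun b hb => by
    simpa [hzero' b hb] using hH A b
  rw [disjoint_union_right] at hSAB
  obtain ⟨hSA, hSB⟩ := hSAB
  set P : Finset V := {x ∈ S | G.degOn B x ≤ G.degOn A x} with hP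
  set Q : Finset V := {x ∈ S | ¬ G.degOn B x ≤ G.degOn A x} with hQ
  have hPS : P ⊆ S := filter_subset _ _
  have hQS : Q ⊆ S := filter_subset _ _
  have hPQ : Disjoint P Q := disjoint_filter_filter_not _ _ _
  have hPQS : P ∪ Q = S := filter_union_filter_not_eq _ _
  have hcardS : #P + #Q = #S := by rw [← card_union_of_disjoint hPQ, hPQS]
  have hcardA : #(A ∪ P) = #A + #P := card_union_of_disjoint (hSA.mono_left hPS).symm
  have hcardB : #(B ∪ Q) = #B + #Q := card_union_of_disjoint (hSB.mono_left hQS).symm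
  have hXY : Disjoint (A ∪ P) (B ∪ Q) := by
    rw [disjoint_union_left, disjoint_union_right, disjoint_union_right]
    exact ⟨⟨hAB, (hSA.mono_left hQS).symm⟩, hSB.mono_left hPS, hPQ⟩
  have hunion : A ∪ P ∪ (B ∪ Q) = univ := by
    rw [← hun, ← hPQS]
    ext; simp only [mem_union]; tauto
  have hcard : #A + #P + (#B + #Q) = Fintype.card V := by
    rw [← hcardA, ← hcardB, ← card_union_of_disjoint hXY, hunion, card_univ]
  refine ⟨A, A ∪ P, B, B ∪ Q, hXY, hunion, ?_, ?_⟩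
  · exact isRobustSide_of_separation hk hℓ hn hdeg hA hB hunion hcard (by omega) hcardA hA' hB'
      fun x hx => (mem_filter.1 hx).2
  · exact isRobustSide_of_separation hk hℓ hn hdeg hB hA (by rw [union_comm, hunion]) (by omega)
      (by omega) hcardB hB' hA' fun x hx => (not_le.1 (mem_filter.1 hx).2).le

/-! ### Rebuilding the cycles and restoring connectivity -/

/-- Deleting a smaller cover would leave vertices in both classes but no edge between them. -/
theorem IsKConnected.le_card_of_coversBetween [Fintype V] {G : SimpleGraph V} {k : ℕ}
    (h : G.IsKConnected k) {X Y C : Finset V} (hXY : Disjoint X Y) (hun : X ∪ Y = univ)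
    (hX : k ≤ #X) (hY : k ≤ #Y) (hC : G.CoversBetween X Y C) : k ≤ #C := by
  by_contra! hlt
  obtain ⟨x, hx, hxC⟩ := exists_mem_notMem_of_card_lt_card (hlt.trans_le hX)
  obtain ⟨y, hy, hyC⟩ := exists_mem_notMem_of_card_lt_card (hlt.trans_le hY)
  have hreach := (h.2 C hlt).preconnected ⟨x, hxC⟩ ⟨y, hyC⟩
  have : y ∈ X := hreach.mem_of_forall_adj (Z := {v : {v : V | v ∉ C} | (v : V) ∈ X}) (fun u v huv hu => by
    have huv' : G.Adj u v := by simpa using huv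
    have hv : (v : V) ∈ X ∪ Y := hun ▸ mem_univ _
    refine (mem_union.1 hv).resolve_right fun hvY => ?_
    exact (hC _ hu _ hvY huv').elim u.2 v.2) hx
  exact Finset.disjoint_left.1 hXY this hy

/-- Two robust sides joined by a matching of `k` edges make a `k`-connected graph. -/
theorem isKConnected_of_robust_partition [Fintype V] {G H : SimpleGraph V} {k ℓ : ℕ}
    {A X B Y : Finset V} (hk : k < Fintype.card V) (hXY : Disjoint X Y) (hun : X ∪ Y = univ)
    (hX : G.IsRobustSide k ℓ A X) (hY : G.IsRobustSide k ℓ B Y)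
    (hH : ∀ Z v, G.degOn Z v ≤ H.degOn Z v + 2 * ℓ) {f g : Fin k → V} (hf : f.Injective)
    (hg : g.Injective) (hfg : ∀ i, f i ∈ X ∧ g i ∈ Y ∧ H.Adj (f i) (g i)) :
    H.IsKConnected k := by
  refine ⟨hk, fun T hT => ?_⟩
  -- Fewer than `k` vertices cannot meet all `k` disjoint matching edges.
  obtain ⟨i, hi⟩ : ∃ i, f i ∉ T ∧ g i ∉ T := by
    by_contra! hno
    have : #(univ : Finset (Fin k)) ≤ #T := by
      refine card_le_card_of_injOn (fun i => if f i ∈ T then f i else g i) (fun i _ => ?_) ?_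
      · by_cases hi : f i ∈ T
        · simp [hi]
        · simpa [hi] using hno i hi
      · intro i _ j _ hij
        have hne : ∀ i j, f i ≠ g j := fun i j h =>
          Finset.disjoint_left.1 hXY (hfg i).1 (h ▸ (hfg j).2.1)
        by_cases hi : f i ∈ T <;> by_cases hj : f j ∈ T <;>
          simp only [hi, hj, if_true, if_false] at hij
        · exact hf hij
        · exact absurd hij (hne _ _)
        · exact absurd hij.symm (hne _ _)
        · exact hg hij
    rw [card_univ, Fintype.card_fin] at this
    omega
  let x : {v : V | v ∉ T} := ⟨f i, hi.1⟩
  let y : {v : V | v ∉ T} := ⟨g i, hi.2⟩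
  have hxy : (H.induce {v : V | v ∉ T}).Adj x y := by simpa [x, y] using (hfg i).2.2
  have hall : ∀ u, (H.induce {v : V | v ∉ T}).Reachable u x := by
    intro u
    have hu : (u : V) ∈ X ∪ Y := hun ▸ mem_univ _
    rcases mem_union.1 hu with hu | hu
    · exact hX.reachable hH hT u x hu (hfg i).1
    · exact (hY.reachable hH hT u y hu (hfg i).2.1).trans hxy.symm.reachable
  exact (connected_iff _).2 ⟨fun u v => (hall u).trans (hall v).symm, ⟨x⟩⟩

theorem degOn_le_add_of_isHamiltonianCycle {G : SimpleGraph V} {ℓ : ℕ} {v : Fin ℓ → V}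
    {H : ∀ i, G.Walk (v i) (v i)} (hH : ∀ i, (H i).IsHamiltonianCycle) (Z : Finset V) (w : V) :
    G.degOn Z w ≤ (G.deleteEdges (⋃ i, (H i).edgeSet)).degOn Z w + 2 * ℓ := by
  refine (degOn_le_add_degOn_fromEdgeSet G (⋃ i, (H i).edgeSet) Z w).trans ?_
  gcongr
  simpa [mul_comm] using degOn_fromEdgeSet_iUnion_le fun i => (hH i).degOn_fromEdgeSet_le Z w

theorem Walk.mem_of_mem_edges {G : SimpleGraph V} {X : Finset V} {a b : V} {p : G.Walk a b}
    (hp : p.support.toFinset = X) {e : Sym2 V} (he : e ∈ p.edges) {v : V} (hv : v ∈ e) :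
    v ∈ X := by
  rw [← hp, List.mem_toFinset]
  exact p.mem_support_of_mem_edges he hv

theorem CrossingPair.exists_mem_of_mem_edges {G : SimpleGraph V} {X Y : Finset V}
    (c : CrossingPair G X Y) {e : Sym2 V} (he : e ∈ c.edges) :
    (∃ v ∈ e, v ∈ X) ∧ ∃ v ∈ e, v ∈ Y := by
  simp only [CrossingPair.edges, mem_insert, mem_singleton] at he
  rcases he with rfl | rfl
  · exact ⟨⟨_, by simp, c.x₁_mem⟩, ⟨_, by simp, c.y₁_mem⟩⟩
  · exact ⟨⟨_, by simp, c.x₂_mem⟩, ⟨_, by simp, c.y₂_mem⟩⟩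

/-- The matching is reserved before the cycles are built. Path edges stay inside one side, so only
crossing pairs could use a matching edge, and these are chosen to avoid the set `U` of matched
vertices. -/
theorem exists_cycles_of_robust_partition [Fintype V] {G : SimpleGraph V} {k ℓ : ℕ} (hk : 2 ≤ k)
    (hcon : G.IsKConnected k) (hdeg : ∀ v, Fintype.card V ≤ 2 * G.degOn univ v)
    {A X B Y : Finset V} (hXY : Disjoint X Y) (hun : X ∪ Y = univ)
    (hX : G.IsRobustSide k ℓ A X) (hY : G.IsRobustSide k ℓ B Y) :
    ∃ (v : Fin ℓ → V) (H : ∀ i, G.Walk (v i) (v i)),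
      G.IsEdgeDisjointHamiltonianCycles v H ∧
        (G.deleteEdges (⋃ i, (H i).edgeSet)).IsKConnected k := by
  classical
  have hXc := hX.le_card
  have hYc := hY.le_card
  obtain ⟨f, g, hf, hg, hfg⟩ := exists_matching_of_le_card_cover hXY fun C hC =>
    hcon.le_card_of_coversBetween hXY hun (by omega) (by omega) hC
  set U : Finset V := univ.image f ∪ univ.image g with hU
  have hUX : #(U ∩ X) ≤ k := by
    refine (card_le_card (t := univ.image f) fun v hv => ?_).trans (card_image_le.trans (by simp))
    simp only [hU, mem_inter, mem_union, mem_image, mem_univ, true_and] at hv ⊢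
    obtain ⟨h | ⟨i, rfl⟩, hv⟩ := hv
    · exact h
    · exact absurd (hfg i).2.1 (Finset.disjoint_left.1 hXY hv)
  have hUY : #(U ∩ Y) ≤ k := by
    refine (card_le_card (t := univ.image g) fun v hv => ?_).trans (card_image_le.trans (by simp))
    simp only [hU, mem_inter, mem_union, mem_image, mem_univ, true_and] at hv ⊢
    obtain ⟨⟨i, rfl⟩ | h, hv⟩ := hv
    · exact absurd hv (Finset.disjoint_left.1 hXY (hfg i).1)
    · exact h
  -- There is room for the greedy choice: each side contains at most `k` vertices of `U` and has at
  -- least `k + 4ℓ` in all.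
  obtain ⟨c, hcU, hcd⟩ := exists_disjoint_crossingPairs_of_partition hXY hun hdeg ℓ U
    (by omega) (by omega)
  obtain ⟨p, hp, hpd⟩ := hX.exists_spanning_paths hk (fun i => (c i).x₁) (fun i => (c i).x₂)
    (fun i => (c i).x₁_mem) (fun i => (c i).x₂_mem) (fun i => (c i).x_ne)
  obtain ⟨q, hq, hqd⟩ := hY.exists_spanning_paths hk (fun i => (c i).y₁) (fun i => (c i).y₂)
    (fun i => (c i).y₁_mem) (fun i => (c i).y₂_mem) (fun i => (c i).y_ne)
  choose H hH hHe using fun i => exists_isHamiltonianCycle_of_paths hXY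
    (fun v => hun ▸ mem_univ v) (hp i).1 (hq i).1 (hp i).2 (hq i).2 (c i).x_ne (c i).adj₁
    (c i).adj₂
  have hHe' : ∀ i e, e ∈ (H i).edgeSet → e ∈ (p i).edges ∨ e ∈ (q i).edges ∨ e ∈ (c i).edges :=
    fun i e he => by simpa [CrossingPair.edges] using (hHe i e).1 he
  have hpX : ∀ i e, e ∈ (p i).edges → ∀ v ∈ e, v ∈ X := fun i e he v hv =>
    Walk.mem_of_mem_edges (hp i).2 he hv
  have hqY : ∀ i e, e ∈ (q i).edges → ∀ v ∈ e, v ∈ Y := fun i e he v hv =>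
    Walk.mem_of_mem_edges (hq i).2 he hv
  have hcX : ∀ i e, e ∈ (c i).edges → ∃ v ∈ e, v ∈ X := fun i e he =>
    ((c i).exists_mem_of_mem_edges he).1
  have hcY : ∀ i e, e ∈ (c i).edges → ∃ v ∈ e, v ∈ Y := fun i e he =>
    ((c i).exists_mem_of_mem_edges he).2
  have hnot : ∀ v, v ∈ X → v ∈ Y → False := fun v h h' => Finset.disjoint_left.1 hXY h h'
  refine ⟨_, H, ⟨hH, fun i j hij => ?_⟩, ?_⟩
  · rw [Set.disjoint_left]
    intro e hei hej
    obtain ⟨w, hw⟩ : ∃ w, w ∈ e := ⟨_, e.out_fst_mem⟩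
    rcases hHe' i e hei with hi | hi | hi <;> rcases hHe' j e hej with hj | hj | hj
    · exact Set.disjoint_left.1 (hpd i j hij) hi hj
    · exact hnot w (hpX _ _ hi w hw) (hqY _ _ hj w hw)
    · obtain ⟨z, hz, hzY⟩ := hcY _ _ hj
      exact hnot z (hpX _ _ hi z hz) hzY
    · exact hnot w (hpX _ _ hj w hw) (hqY _ _ hi w hw)
    · exact Set.disjoint_left.1 (hqd i j hij) hi hj
    · obtain ⟨z, hz, hzX⟩ := hcX _ _ hj
      exact hnot z hzX (hqY _ _ hi z hz)
    · obtain ⟨z, hz, hzY⟩ := hcY _ _ hi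
      exact hnot z (hpX _ _ hj z hz) hzY
    · obtain ⟨z, hz, hzX⟩ := hcX _ _ hi
      exact hnot z hzX (hqY _ _ hj z hz)
    · exact Finset.disjoint_left.1 (hcd i j hij) hi hj
  · refine isKConnected_of_robust_partition hcon.1 hXY hun hX hY
      (degOn_le_add_of_isHamiltonianCycle hH) hf hg fun i => ⟨(hfg i).1, (hfg i).2.1, ?_⟩
    rw [deleteEdges_adj]
    refine ⟨(hfg i).2.2, fun hmem => ?_⟩
    obtain ⟨j, hj⟩ := Set.mem_iUnion.1 hmem
    rcases hHe' j _ hj with hj | hj | hj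
    · exact hnot _ (hpX _ _ hj (g i) (by simp)) (hfg i).2.1
    · exact hnot _ (hfg i).1 (hqY _ _ hj (f i) (by simp))
    · refine Finset.disjoint_left.1 ((hcU j).disjoint_edges (E := {s(f i, g i)}) ?_)
        (mem_singleton_self _) hj
      intro e he v hv
      rw [mem_singleton.1 he, Sym2.mem_iff] at hv
      rcases hv with rfl | rfl <;> simp [hU]

end SimpleGraph

theorem corollary4p5 {V : Type*} [Fintype V] [DecidableEq V]
    (G : SimpleGraph V) [DecidableRel G.Adj] (k ℓ : ℕ) (hk : 2 ≤ k) (hℓ : 2 ≤ ℓ)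
    (hconn : G.IsKConnected k)
    (hn : max ((k : ℤ) * ℓ + max ((k : ℤ) * ℓ) (6 * ℓ + 2) + 3 * k + 2 * ℓ - 6)
        (6 * (k : ℤ) + 20 * ℓ - 8 - 2 * ⌈((k : ℚ) - 2) / k⌉) ≤ (Fintype.card V : ℤ))
    (hδ : (Fintype.card V : ℚ) / 2 ≤ (G.minDegree : ℚ))
    (hG : ∃ (v : Fin ℓ → V) (H : ∀ i, G.Walk (v i) (v i)),
      G.IsEdgeDisjointHamiltonianCycles v H) :
    ∃ (v : Fin ℓ → V) (H : ∀ i, G.Walk (v i) (v i)),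
      G.IsEdgeDisjointHamiltonianCycles v H ∧
        (G.deleteEdges (⋃ i, (H i).edgeSet)).IsKConnected k := by
  obtain ⟨v, H, hH⟩ := hG
  by_cases hcon : (G.deleteEdges (⋃ i, (H i).edgeSet)).IsKConnected k
  · exact ⟨v, H, hH, hcon⟩
  -- This turns the second bound of `hn` into `n ≥ 6k + 20ℓ - 10`.
  have hceil : ⌈((k : ℚ) - 2) / k⌉ ≤ 1 := by
    rw [Int.ceil_le]
    have : (0 : ℚ) < k := by exact_mod_cast (by omega : 0 < k)
    rw [div_le_iff₀ this]
    push_cast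
    linarith
  have hn' : 6 * k + 20 * ℓ ≤ Fintype.card V + 10 := by
    have := (le_max_right _ _).trans hn
    omega
  have hdeg : ∀ w, Fintype.card V ≤ 2 * G.degOn Finset.univ w := by
    intro w
    have h1 : (Fintype.card V : ℚ) ≤ 2 * G.minDegree := by linarith
    have h2 : Fintype.card V ≤ 2 * G.minDegree := by exact_mod_cast h1
    have h3 : G.degree w = G.degOn Finset.univ w := by
      rw [← SimpleGraph.card_neighborFinset_eq_degree, SimpleGraph.degOn]
      congr 1
      ext
      simp
    have := G.minDegree_le_degree w
    omega
  obtain ⟨A, X, B, Y, hXY, hun, hX, hY⟩ := SimpleGraph.exists_robust_partition hk hℓ hn' hdeg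
    (SimpleGraph.degOn_le_add_of_isHamiltonianCycle hH.1) hcon
  exact SimpleGraph.exists_cycles_of_robust_partition hk hconn hdeg hXY hun hX hY
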